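/- Let $(\mathbb{H},\rho)$ be a complete separable metric space with its Borel $\sigma$-algebra, and let $\mathcal{P}(\mathbb{H})$ be the set of Borel probability measures on $\mathbb{H}$. For $P,Q\in\mathcal{P}(\mathbb{H})$ let $$\pi(P,Q)=\inf\{\varepsilon>0:\ P(A)\le Q(A^{\varepsilon})+\varepsilon\ \text{ for all closed sets } A\subseteq\mathbb{H}\},\qquad A^{\varepsilon}=\{x:\ \rho(x,a)<\varepsilon\ \text{for some } a\in A\},$$ be the Lévy–Prokhorov distance; $\pi$ is defined in the same way on every other complete separable metric space. Write $P_X$ for the distribution of a random element $X$. Two metrics $r_1,r_2$ on a set are called uniformly equivalent if, for any two sequences $(x_n),(y_n)$ in it, $r_1(x_n,y_n)\to0$ if and only if $r_2(x_n,y_n)\to0$. Then $\pi$ is a metric on $\mathcal{P}(\mathbb{H})$, and it has the following properties. (A) If $X_n,Y_n$ ($n\ge1$) are $\mathbb{H}$-valued random elements on one probability space and $\rho(X_n,Y_n)\to0$ in probability, then $\pi(P_{X_n},P_{Y_n})\to0$. (B) If $P_n,Q_n\in\mathcal{P}(\mathbb{H})$ and $\pi(P_n,Q_n)\to0$, then there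 exist a probability space and $\mathbb{H}$-valued random elements $X_n,Y_n$ ($n\ge1$) on it such that $P_{X_n}=P_n$ and $P_{Y_n}=Q_n$ for all $n$, and $\rho(X_n,Y_n)\to0$ in probability. (C) If $P_n,Q_n\in\mathcal{P}(\mathbb{H})$ and $\pi(P_n,Q_n)\to0$, then $\pi(P_n\circ f^{-1},Q_n\circ f^{-1})\to0$ for every uniformly continuous map $f$ from $\mathbb{H}$ to a complete separable metric space, in particular for every uniformly continuous $f:\mathbb{H}\to\mathbb{R}$. (D) If $P_n,Q\in\mathcal{P}(\mathbb{H})$, then $\pi(P_n,Q)\to0$ if and only if $\int f\,dP_n\to\int f\,dQ$ for every bounded continuous $f:\mathbb{H}\to\mathbb{R}$. Moreover, $\pi$ is, up to uniform equivalence, the only such metric: every metric $r$ on $\mathcal{P}(\mathbb{H})$ that satisfies (A) and (B) with $r$ in place of $\pi$ (in particular, every one that has all four properties) is uniformly equivalent to $\pi$. -/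

import Mathlib

open MeasureTheory Filter Topology
open scoped ENNReal BoundedContinuousFunction

universe u v w

/-- The Lévy–Prokhorov distance of two Borel probability measures. -/
noncomputable def lpDist {H : Type u} [MetricSpace H] [MeasurableSpace H]
    (P Q : ProbabilityMeasure H) : ℝ :=
  levyProkhorovDist (P : Measure H) (Q : Measure H)

/-- The one-sided closed-set formula
`π(P, Q) = inf {ε > 0 : P(A) ≤ Q(A^ε) + ε for all closed A}`,
where `A^ε` is the open `ε`-neighbourhood of `A`. -/
theorem lpDist_eq_sInf {H : Type u} [MetricSpace H] [MeasurableSpace H] [BorelSpace H]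
    (P Q : ProbabilityMeasure H) :
    lpDist P Q = sInf {ε : ℝ | 0 < ε ∧ ∀ A : Set H, IsClosed A →
      (P : Measure H) A ≤ (Q : Measure H) (Metric.thickening ε A) + ENNReal.ofReal ε} := by
  have one : ∀ {ε : ℝ}, (∀ A : Set H, IsClosed A →
      (P : Measure H) A ≤ (Q : Measure H) (Metric.thickening ε A) + ENNReal.ofReal ε) →
      ∀ B : Set H, MeasurableSet B →
      (P : Measure H) B ≤ (Q : Measure H) (Metric.thickening ε B) + ENNReal.ofReal ε ∧
      (Q : Measure H) B ≤ (P : Measure H) (Metric.thickening ε B) + ENNReal.ofReal ε := by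
    intro ε h B hB
    constructor
    · calc (P : Measure H) B ≤ (P : Measure H) (closure B) := measure_mono subset_closure
        _ ≤ _ := h _ isClosed_closure
        _ = _ := by rw [Metric.thickening_closure]
    · have hT : MeasurableSet (Metric.thickening ε B) := Metric.isOpen_thickening.measurableSet
      have h1 := h _ (Metric.isOpen_thickening (δ := ε) (E := B)).isClosed_compl
      have h2 : Metric.thickening ε (Metric.thickening ε B)ᶜ ⊆ Bᶜ := by
        intro x hx hxB
        rw [Metric.mem_thickening_iff] at hx
        obtain ⟨z, hz, hxz⟩ := hx
        exact hz (Metric.mem_thickening_iff.2 ⟨x, hxB, by rwa [dist_comm]⟩)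
      have h3 : (P : Measure H) (Metric.thickening ε B)ᶜ ≤
          (Q : Measure H) Bᶜ + ENNReal.ofReal ε :=
        h1.trans (by gcongr)
      calc (Q : Measure H) B
          = (Q : Measure H) B + 0 := (add_zero _).symm
        _ ≤ (P : Measure H) (Metric.thickening ε B) + ENNReal.ofReal ε := by
            rw [add_zero]
            have e1 := prob_add_prob_compl (μ := (Q : Measure H)) hB
            have e2 := prob_add_prob_compl (μ := (P : Measure H)) hT
            have hfin : (Q : Measure H) Bᶜ ≠ ∞ := measure_ne_top _ _
            refine (ENNReal.add_le_add_iff_right hfin).1 ?_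
            rw [e1, ← e2, add_assoc]
            gcongr
            rw [add_comm]
            exact h3
  unfold lpDist levyProkhorovDist
  apply le_antisymm
  · refine le_csInf ⟨1, one_pos, fun A _ => ?_⟩ ?_
    · rw [ENNReal.ofReal_one]
      exact prob_le_one.trans le_add_self
    · rintro ε ⟨hε, h⟩
      refine ENNReal.toReal_le_of_le_ofReal hε.le (sInf_le ?_)
      intro B hB
      rw [ENNReal.toReal_ofReal hε.le]
      exact one h B hB
  · refine le_of_forall_pos_le_add fun δ hδ => csInf_le ⟨0, fun x hx => hx.1.le⟩ ?_
    refine ⟨by positivity, fun A hA => ?_⟩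
    have hlt : levyProkhorovEDist (P : Measure H) Q <
        ENNReal.ofReal ((levyProkhorovEDist (P : Measure H) Q).toReal + δ) := by
      rw [ENNReal.lt_ofReal_iff_toReal_lt (levyProkhorovEDist_ne_top _ _)]
      linarith
    have := left_measure_le_of_levyProkhorovEDist_lt hlt hA.measurableSet
    rwa [ENNReal.toReal_ofReal (by positivity)] at this

/-- `r` is a metric on the set `M`. -/
structure IsMetric {M : Type u} (r : M → M → ℝ) : Prop where
  nonneg : ∀ x y, 0 ≤ r x y
  eq_zero_iff : ∀ x y, r x y = 0 ↔ x = y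
  symm : ∀ x y, r x y = r y x
  triangle : ∀ x y z, r x z ≤ r x y + r y z

/-- Uniform equivalence of two metrics, through sequences. -/
def UniformlyEquivalent {M : Type u} (r₁ r₂ : M → M → ℝ) : Prop :=
  ∀ x y : ℕ → M, Tendsto (fun n => r₁ (x n) (y n)) atTop (𝓝 0) ↔
    Tendsto (fun n => r₂ (x n) (y n)) atTop (𝓝 0)

/-- Condition A for `r`: if `ρ(X_n, Y_n) → 0` in probability, then `r(P_{X_n}, P_{Y_n}) → 0`. -/
def CondA {H : Type u} [MetricSpace H] [MeasurableSpace H]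
    (r : ProbabilityMeasure H → ProbabilityMeasure H → ℝ) : Prop :=
  ∀ (Ω : Type w) [MeasurableSpace Ω] (μ : ProbabilityMeasure Ω) (X Y : ℕ → Ω → H)
    (hX : ∀ n, Measurable (X n)) (hY : ∀ n, Measurable (Y n)),
    TendstoInMeasure (μ : Measure Ω) (fun n ω => dist (X n ω) (Y n ω)) atTop (fun _ => 0) →
    Tendsto (fun n => r (μ.map (hX n).aemeasurable) (μ.map (hY n).aemeasurable)) atTop (𝓝 0)

/-- Condition B for `r`: if `r(P_n, Q_n) → 0`, then there are random elements `X_n ∼ P_n` and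
`Y_n ∼ Q_n`, all on one probability space, with `ρ(X_n, Y_n) → 0` in probability. -/
def CondB {H : Type u} [MetricSpace H] [MeasurableSpace H]
    (r : ProbabilityMeasure H → ProbabilityMeasure H → ℝ) : Prop :=
  ∀ P Q : ℕ → ProbabilityMeasure H, Tendsto (fun n => r (P n) (Q n)) atTop (𝓝 0) →
    ∃ (Ω : Type w) (_ : MeasurableSpace Ω) (μ : ProbabilityMeasure Ω) (X Y : ℕ → Ω → H)
      (hX : ∀ n, Measurable (X n)) (hY : ∀ n, Measurable (Y n)),
      (∀ n, μ.map (hX n).aemeasurable = P n) ∧ (∀ n, μ.map (hY n).aemeasurable = Q n) ∧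
      TendstoInMeasure (μ : Measure Ω) (fun n ω => dist (X n ω) (Y n ω)) atTop (fun _ => 0)

/-- Condition C for metrics `r` and `s` on the laws on `H` and on `K`: `r(P_n, Q_n) → 0` implies
`s(P_n ∘ f⁻¹, Q_n ∘ f⁻¹) → 0` for every uniformly continuous `f : H → K`. -/
def CondC {H : Type u} [MetricSpace H] [MeasurableSpace H] [BorelSpace H]
    {K : Type v} [MetricSpace K] [MeasurableSpace K] [BorelSpace K]
    (r : ProbabilityMeasure H → ProbabilityMeasure H → ℝ)
    (s : ProbabilityMeasure K → ProbabilityMeasure K → ℝ) : Prop :=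
  ∀ (f : H → K) (hf : UniformContinuous f) (P Q : ℕ → ProbabilityMeasure H),
    Tendsto (fun n => r (P n) (Q n)) atTop (𝓝 0) →
    Tendsto (fun n => s ((P n).map hf.continuous.measurable.aemeasurable)
      ((Q n).map hf.continuous.measurable.aemeasurable)) atTop (𝓝 0)

/-- Condition D for `r`: `r(P_n, Q) → 0` is the same as weak convergence of `P_n` to `Q` with
respect to all bounded continuous functions. -/
def CondD {H : Type u} [MetricSpace H] [MeasurableSpace H]
    (r : ProbabilityMeasure H → ProbabilityMeasure H → ℝ) : Prop :=
  ∀ (P : ℕ → ProbabilityMeasure H) (Q : ProbabilityMeasure H),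
    Tendsto (fun n => r (P n) Q) atTop (𝓝 0) ↔
    ∀ f : H →ᵇ ℝ, Tendsto (fun n => ∫ x, f x ∂(P n : Measure H)) atTop
      (𝓝 (∫ x, f x ∂(Q : Measure H)))

/-!
The substance lies in condition B, which comes from an approximate form of Strassen's theorem
(`exists_coupling_of_lpDist_lt`): if `π(P, Q) < ε`, then `P` and `Q` have a coupling under which
`3 ε < dist x y` has probability at most `4 ε`. To construct it, cut the space into countably many
cells of diameter at most `ε`, keep finitely many of them that carry almost all of the mass of `P`
and of `Q`, and relate two cells when they come within `ε` of each other. The inequality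
`P A ≤ Q (A^ε) + ε` for unions of cells is the marriage condition, up to a small deficiency, for the
bipartite graph of related cells. A fractional form of Hall's theorem (`exists_transport_of_hall`)
then moves all but a small part of the mass between related cells. The transport plan becomes a
measure on the product by spreading the mass sent from one cell to another as the product of the
conditional laws (`exists_subcoupling`), and the small remainder is coupled arbitrarily
(`exists_coupling_le_add_missing_mass`). Given sequences `P n`, `Q n`, the product of such couplings
carries all the random elements at once. It lives on a standard Borel space, by completeness, so
that it can be replaced by a law on a copy of `ℝ` in any universe
(`exists_random_elements_map_eq`).

Conditions A and C are direct estimates with thickenings, and D is the known fact that the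
Lévy–Prokhorov metric metrizes convergence in distribution on a separable space. Uniqueness is
formal: if `r (P n) (Q n) → 0`, then B for `r` represents the laws by random elements whose
distances tend to zero in probability, and A for `π` gives `π (P n) (Q n) → 0`; the roles of `r` and
`π` can be exchanged.
-/

/-! ### Transport plans on finite bipartite graphs -/

open Finset Classical in
/-- A fractional, approximate form of Hall's marriage theorem with deficiency `c` (equivalently, of
max-flow min-cut for a bipartite graph): if the supplies `p` satisfy the marriage condition with
respect to the demands `q` up to `c`, then all but `c + η` of the supply can be transported along
`R`. The weights are cut into units of size `1 / N`, and Hall's theorem is applied to the units. -/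
theorem exists_transport_of_hall {ι κ : Type*} [Fintype ι] [Fintype κ] (R : ι → κ → Prop)
    (p : ι → NNReal) (q : κ → NNReal) (c η : NNReal) (hη : 0 < η)
    (h : ∀ S : Finset ι, ∑ i ∈ S, p i ≤ ∑ j with ∃ i ∈ S, R i j, q j + c) :
    ∃ w : ι → κ → NNReal, (∀ i j, w i j ≠ 0 → R i j) ∧ (∀ i, ∑ j, w i j ≤ p i) ∧
      (∀ j, ∑ i, w i j ≤ q j) ∧ ∑ i, p i ≤ ∑ i, ∑ j, w i j + c + η := by
  obtain ⟨N, hN⟩ := exists_nat_gt ((Fintype.card ι + Fintype.card κ + 1 : NNReal) / η)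
  have hN0 : (0 : NNReal) < N := lt_of_le_of_lt zero_le hN
  rw [div_lt_iff₀ hη] at hN
  -- `a i` and `b j` count the whole units in `p i` and `q j`. The `d` dummy demands, compatible with
  -- every supply unit, absorb both the deficiency and the rounding error.
  set a : ι → ℕ := fun i => ⌊N * p i⌋₊
  set b : κ → ℕ := fun j => ⌊N * q j⌋₊
  set d : ℕ := ⌈N * c⌉₊ + Fintype.card κ
  have ha : ∀ i, (a i : NNReal) ≤ N * p i := fun i => Nat.floor_le zero_le
  have hb : ∀ j, (b j : NNReal) ≤ N * q j := fun j => Nat.floor_le zero_le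
  have ha' : ∀ i, N * p i ≤ a i + 1 := fun i => (Nat.lt_floor_add_one _).le
  have hb' : ∀ j, N * q j ≤ b j + 1 := fun j => (Nat.lt_floor_add_one _).le
  let t : (Σ i, Fin (a i)) → Finset ((Σ j, Fin (b j)) ⊕ Fin d) := fun x =>
    (univ.filter fun y : Σ j, Fin (b j) => R x.1 y.1).disjSum univ
  obtain ⟨f, hf, hft⟩ := (Finset.all_card_le_biUnion_card_iff_exists_injective t).1 (by
    intro s
    obtain rfl | ⟨x₀, hx₀⟩ := s.eq_empty_or_nonempty
    · simp
    set S := s.image Sigma.fst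
    set T := univ.filter fun j => ∃ i ∈ S, R i j
    have h1 : #s ≤ ∑ i ∈ S, a i := by
      calc #s ≤ #(S.sigma fun i => (univ : Finset (Fin (a i)))) :=
            card_le_card fun x hx =>
              mem_sigma.2 ⟨mem_image_of_mem Sigma.fst hx, mem_univ _⟩
        _ = _ := by simp
    have h2 : (T.sigma fun j => (univ : Finset (Fin (b j)))).disjSum (univ : Finset (Fin d)) ⊆
        s.biUnion t := by
      intro z hz
      rw [mem_biUnion]
      rcases z with ⟨j, l⟩ | z
      · simp only [inl_mem_disjSum, mem_sigma, mem_univ, and_true, T, S, mem_filter, true_and,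
          mem_image] at hz
        obtain ⟨_, ⟨x, hx, rfl⟩, hR⟩ := hz
        exact ⟨x, hx, by simpa [t] using hR⟩
      · exact ⟨x₀, hx₀, by simp [t]⟩
    refine h1.trans (le_trans ?_ (card_le_card h2))
    rw [card_disjSum, card_sigma]
    simp only [card_univ, Fintype.card_fin]
    have h3 : (∑ i ∈ S, a i : NNReal) ≤ ∑ j ∈ T, (b j : NNReal) + d := by
      calc (∑ i ∈ S, a i : NNReal) ≤ ∑ i ∈ S, N * p i := sum_le_sum fun i _ => ha i
        _ = N * ∑ i ∈ S, p i := by rw [mul_sum]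
        _ ≤ N * (∑ j ∈ T, q j + c) := by gcongr; exact h S
        _ = ∑ j ∈ T, N * q j + N * c := by rw [mul_add, mul_sum]
        _ ≤ ∑ j ∈ T, ((b j : NNReal) + 1) + ⌈N * c⌉₊ := by
            gcongr with j
            · exact hb' j
            · exact Nat.le_ceil _
        _ = ∑ j ∈ T, (b j : NNReal) + (⌈N * c⌉₊ + #T) := by
            rw [sum_add_distrib]; simp; ring
        _ ≤ _ := by
            simp only [d]; push_cast
            gcongr
            exact card_le_univ T
    exact_mod_cast h3)
  -- The pairs of units matched to each other; supply units sent to a dummy demand are dropped.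
  set M : Finset ((Σ i, Fin (a i)) × (Σ j, Fin (b j))) := univ.filter fun z => f z.1 = Sum.inl z.2
  have hM : ∀ z, z ∈ M ↔ f z.1 = Sum.inl z.2 := fun z => by simp [M]
  have hrow : ∀ i, ∑ j, #{z ∈ M | z.1.1 = i ∧ z.2.1 = j} = #{z ∈ M | z.1.1 = i} := by
    intro i
    rw [card_eq_sum_card_fiberwise (f := fun z => z.2.1) (t := univ) (by simp)]
    simp only [filter_filter]
  have hcol : ∀ j, ∑ i, #{z ∈ M | z.1.1 = i ∧ z.2.1 = j} = #{z ∈ M | z.2.1 = j} := by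
    intro j
    rw [card_eq_sum_card_fiberwise (f := fun z => z.1.1) (t := univ) (by simp)]
    simp only [filter_filter, and_comm]
  have hrow' : ∀ i, #{z ∈ M | z.1.1 = i} ≤ a i := by
    intro i
    calc #{z ∈ M | z.1.1 = i} ≤ #(({i} : Finset ι).sigma fun i => (univ : Finset (Fin (a i)))) := by
          refine card_le_card_of_injOn Prod.fst (fun z hz => ?_) ?_
          · simpa using (mem_filter.1 hz).2
          · intro z hz z' hz' e
            have h1 := (hM z).1 (mem_filter.1 hz).1
            have h2 := (hM z').1 (mem_filter.1 hz').1
            rw [e, h2] at h1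
            exact Prod.ext e (Sum.inl_injective h1).symm
      _ = a i := by simp
  have hcol' : ∀ j, #{z ∈ M | z.2.1 = j} ≤ b j := by
    intro j
    calc #{z ∈ M | z.2.1 = j} ≤ #(({j} : Finset κ).sigma fun j => (univ : Finset (Fin (b j)))) := by
          refine card_le_card_of_injOn Prod.snd (fun z hz => ?_) ?_
          · simpa using (mem_filter.1 hz).2
          · intro z hz z' hz' e
            have h1 := (hM z).1 (mem_filter.1 hz).1
            have h2 := (hM z').1 (mem_filter.1 hz').1
            exact Prod.ext (hf (by rw [h1, h2, e])) e
      _ = b j := by simp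
  have htot : ∑ i, a i ≤ #M + d := by
    calc ∑ i, a i = #(univ : Finset (Σ i, Fin (a i))) := by simp
      _ = #((univ : Finset (Σ i, Fin (a i))).image f) := (card_image_of_injective _ hf).symm
      _ ≤ #((M.image Prod.snd).disjSum (univ : Finset (Fin d))) := by
          refine card_le_card fun z hz => ?_
          obtain ⟨x, -, hx⟩ := mem_image.1 hz
          rcases z with y | y
          · exact inl_mem_disjSum.2 (mem_image.2 ⟨(x, y), (hM _).2 hx, rfl⟩)
          · simp
      _ ≤ #M + d := by
          rw [card_disjSum]; gcongr
          · exact card_image_le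
          · simp
  -- The amount sent from `i` to `j` is the number of unit pairs lying over `(i, j)`.
  refine ⟨fun i j => #{z ∈ M | z.1.1 = i ∧ z.2.1 = j} / N, fun i j hij => ?_, fun i => ?_,
    fun j => ?_, ?_⟩
  · have : #{z ∈ M | z.1.1 = i ∧ z.2.1 = j} ≠ 0 := fun h0 => hij (by simp [h0])
    obtain ⟨z, hz⟩ := card_ne_zero.1 this
    obtain ⟨hzM, rfl, rfl⟩ := mem_filter.1 hz
    have := hft z.1
    rw [(hM z).1 hzM] at this
    simpa [t] using this
  · rw [← sum_div, div_le_iff₀' hN0, ← Nat.cast_sum, hrow]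
    exact (Nat.cast_le.2 (hrow' i)).trans (ha i)
  · rw [← sum_div, div_le_iff₀' hN0, ← Nat.cast_sum, hcol]
    exact (Nat.cast_le.2 (hcol' j)).trans (hb j)
  · have e : ∑ i, #{z ∈ M | z.1.1 = i} = #M :=
      (card_eq_sum_card_fiberwise
        (f := fun z : (Σ i, Fin (a i)) × (Σ j, Fin (b j)) => z.1.1) (t := univ) (by simp)).symm
    simp_rw [← sum_div, ← Nat.cast_sum, hrow, e]
    have hd : (d : NNReal) ≤ N * c + 1 + Fintype.card κ := by
      simp only [d]; push_cast; gcongr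
      exact (Nat.ceil_lt_add_one zero_le).le
    refine le_of_mul_le_mul_left ?_ hN0
    calc N * ∑ i, p i = ∑ i, N * p i := by rw [mul_sum]
      _ ≤ ∑ i, ((a i : NNReal) + 1) := sum_le_sum fun i _ => ha' i
      _ = ((∑ i, a i : ℕ) : NNReal) + Fintype.card ι := by simp [sum_add_distrib]
      _ ≤ ((#M + d : ℕ) : NNReal) + Fintype.card ι := by gcongr
      _ ≤ #M + (N * c + 1 + Fintype.card κ) + Fintype.card ι := by push_cast; gcongr
      _ = #M + N * c + (Fintype.card ι + Fintype.card κ + 1) := by ring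
      _ ≤ #M + N * c + N * η := by gcongr
      _ = N * (#M / N + c + η) := by field_simp

/-! ### Couplings from transport plans -/

/-- A measure on the product whose marginals lie below `P` and `Q` extends to a coupling of `P` and
`Q`, by adding a multiple of the product of the two missing marginals. -/
theorem exists_coupling_le_add_missing_mass {α β : Type*} [MeasurableSpace α] [MeasurableSpace β]
    {P : Measure α} {Q : Measure β} [IsProbabilityMeasure P] [IsProbabilityMeasure Q]
    {γ : Measure (α × β)} (h1 : γ.fst ≤ P) (h2 : γ.snd ≤ Q) :
    ∃ Γ : Measure (α × β), Γ.fst = P ∧ Γ.snd = Q ∧ ∀ s, Γ s ≤ γ s + (1 - γ Set.univ) := by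
  have hle : γ Set.univ ≤ 1 := by
    calc γ Set.univ = γ.fst Set.univ := Measure.fst_univ.symm
      _ ≤ P Set.univ := h1 _
      _ = 1 := measure_univ
  have : IsFiniteMeasure γ := ⟨hle.trans_lt ENNReal.one_lt_top⟩
  set A := P - γ.fst
  set B := Q - γ.snd
  set s := 1 - γ Set.univ
  have hA : A Set.univ = s := by
    rw [Measure.sub_apply .univ h1, measure_univ, Measure.fst_univ]
  have hB : B Set.univ = s := by
    rw [Measure.sub_apply .univ h2, measure_univ, Measure.snd_univ]
  have hs : s ≠ ∞ := by finiteness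
  -- For `s = 0` the missing marginals vanish, so that the value `s⁻¹ = ∞` does no harm.
  have hsmul : s⁻¹ • s • A = A ∧ s⁻¹ • s • B = B := by
    by_cases h0 : s = 0
    · rw [h0, Measure.measure_univ_eq_zero] at hA hB
      simp [hA, hB]
    · simp_rw [smul_smul, ENNReal.inv_mul_cancel h0 hs, one_smul, and_self]
  have hfst : (A.prod B).fst = s • A := by rw [Measure.fst, Measure.map_fst_prod, hB]
  have hsnd : (A.prod B).snd = s • B := by rw [Measure.snd, Measure.map_snd_prod, hA]
  refine ⟨γ + s⁻¹ • A.prod B, ?_, ?_, fun t => ?_⟩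
  · rw [Measure.fst_add, Measure.fst, Measure.fst, Measure.map_smul, ← Measure.fst,
      ← Measure.fst, hfst, hsmul.1, add_comm]
    exact Measure.sub_add_cancel_of_le h1
  · rw [Measure.snd_add, Measure.snd, Measure.snd, Measure.map_smul, ← Measure.snd,
      ← Measure.snd, hsnd, hsmul.2, add_comm]
    exact Measure.sub_add_cancel_of_le h2
  · rw [Measure.add_apply]
    gcongr
    calc (s⁻¹ • A.prod B) t ≤ (s⁻¹ • A.prod B) Set.univ := measure_mono (Set.subset_univ _)
      _ = s⁻¹ * s * s := by
        rw [Measure.smul_apply, ← Set.univ_prod_univ, Measure.prod_prod, hA, hB, smul_eq_mul,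
          mul_assoc]
      _ ≤ 1 * s := by gcongr; exact ENNReal.inv_mul_le_one _
      _ = s := one_mul _

open ProbabilityTheory in
/-- A transport plan `w` between the cells of two families of disjoint sets, with supplies `P (A i)`
and demands `Q (B j)`, is realised by the measure `∑ w i j • P[|A i] ⊗ Q[|B j]`, which is carried by
the products `A i ×ˢ B j` with `w i j ≠ 0`. -/
theorem exists_subcoupling {α β : Type*} [MeasurableSpace α] [MeasurableSpace β]
    (P : Measure α) (Q : Measure β) [IsFiniteMeasure P] [IsFiniteMeasure Q]
    {ι κ : Type*} [Fintype ι] [Fintype κ] {A : ι → Set α} {B : κ → Set β}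
    (hA : ∀ i, MeasurableSet (A i)) (hB : ∀ j, MeasurableSet (B j))
    (hAd : Pairwise (Function.onFun Disjoint A)) (hBd : Pairwise (Function.onFun Disjoint B))
    (w : ι → κ → NNReal) (hw : ∀ i, ∑ j, (w i j : ℝ≥0∞) ≤ P (A i))
    (hw' : ∀ j, ∑ i, (w i j : ℝ≥0∞) ≤ Q (B j)) :
    ∃ γ : Measure (α × β), γ.fst ≤ P ∧ γ.snd ≤ Q ∧ γ Set.univ = ∑ i, ∑ j, (w i j : ℝ≥0∞) ∧
      ∀ s, (∀ i j, w i j ≠ 0 → Disjoint s (A i ×ˢ B j)) → γ s = 0 := by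
  have key : ∀ s t, (∑ i, ∑ j, (w i j : ℝ≥0∞) • P[|A i].prod Q[|B j]) (s ×ˢ t) =
      ∑ i, ∑ j, (w i j : ℝ≥0∞) * (P[|A i] s * Q[|B j] t) := fun s t => by
    simp only [Measure.coe_finsetSum, Finset.sum_apply, Measure.smul_apply, smul_eq_mul,
      Measure.prod_prod]
  refine ⟨∑ i, ∑ j, (w i j : ℝ≥0∞) • P[|A i].prod Q[|B j], ?_, ?_, ?_, fun s hs => ?_⟩
  · refine Measure.le_iff.2 fun s hs => ?_
    rw [Measure.fst_apply hs, ← Set.prod_univ, key]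
    calc ∑ i, ∑ j, (w i j : ℝ≥0∞) * (P[|A i] s * Q[|B j] Set.univ)
        ≤ ∑ i, ∑ j, (w i j : ℝ≥0∞) * (P[|A i] s * 1) := by gcongr; exact prob_le_one
      _ = ∑ i, (∑ j, (w i j : ℝ≥0∞)) * P[|A i] s := by simp [Finset.sum_mul]
      _ ≤ ∑ i, P (A i) * P[|A i] s := by gcongr with i; exact hw i
      _ = ∑ i, P (A i ∩ s) := by simp_rw [mul_comm (P _), cond_mul_eq_inter (hA _)]
      _ = P (⋃ i, A i ∩ s) := by
        rw [measure_iUnion (fun i j hij => (hAd hij).mono Set.inter_subset_left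
          Set.inter_subset_left) (fun i => (hA i).inter hs), tsum_fintype]
      _ ≤ P s := measure_mono (Set.iUnion_subset fun i => Set.inter_subset_right)
  · refine Measure.le_iff.2 fun s hs => ?_
    rw [Measure.snd_apply hs, ← Set.univ_prod, key, Finset.sum_comm]
    calc ∑ j, ∑ i, (w i j : ℝ≥0∞) * (P[|A i] Set.univ * Q[|B j] s)
        ≤ ∑ j, ∑ i, (w i j : ℝ≥0∞) * (1 * Q[|B j] s) := by gcongr; exact prob_le_one
      _ = ∑ j, (∑ i, (w i j : ℝ≥0∞)) * Q[|B j] s := by simp [Finset.sum_mul]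
      _ ≤ ∑ j, Q (B j) * Q[|B j] s := by gcongr with j; exact hw' j
      _ = ∑ j, Q (B j ∩ s) := by simp_rw [mul_comm (Q _), cond_mul_eq_inter (hB _)]
      _ = Q (⋃ j, B j ∩ s) := by
        rw [measure_iUnion (fun i j hij => (hBd hij).mono Set.inter_subset_left
          Set.inter_subset_left) (fun j => (hB j).inter hs), tsum_fintype]
      _ ≤ Q s := measure_mono (Set.iUnion_subset fun i => Set.inter_subset_right)
  · rw [← Set.univ_prod_univ, key]
    refine Finset.sum_congr rfl fun i _ => Finset.sum_congr rfl fun j _ => ?_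
    by_cases h0 : w i j = 0
    · simp [h0]
    have hpos : (0 : ℝ≥0∞) < w i j := by simpa [pos_iff_ne_zero] using h0
    have hP : P (A i) ≠ 0 := (hpos.trans_le ((Finset.single_le_sum
      (f := fun j => (w i j : ℝ≥0∞)) (fun _ _ => zero_le) (Finset.mem_univ j)).trans (hw i))).ne'
    have hQ : Q (B j) ≠ 0 := (hpos.trans_le ((Finset.single_le_sum
      (f := fun i => (w i j : ℝ≥0∞)) (fun _ _ => zero_le) (Finset.mem_univ i)).trans (hw' j))).ne'
    have := cond_isProbabilityMeasure hP
    have := cond_isProbabilityMeasure hQ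
    simp
  · simp only [Measure.coe_finsetSum, Finset.sum_apply, Measure.smul_apply, smul_eq_mul,
      Finset.sum_eq_zero_iff, Finset.mem_univ, true_imp_iff, mul_eq_zero, ENNReal.coe_eq_zero]
    intro i j
    by_cases h0 : w i j = 0
    · exact Or.inl h0
    right
    have h1 := Measure.quasiMeasurePreserving_fst (μ := P[|A i]) (ν := Q[|B j]) |>.ae
      (ae_cond_mem (μ := P) (hA i))
    have h2 := Measure.quasiMeasurePreserving_snd (μ := P[|A i]) (ν := Q[|B j]) |>.ae
      (ae_cond_mem (μ := Q) (hB j))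
    rw [measure_eq_zero_iff_ae_notMem]
    filter_upwards [h1, h2] with z hz1 hz2 hzs
    exact Set.disjoint_left.1 (hs i j h0) hzs ⟨hz1, hz2⟩

/-! ### The Lévy–Prokhorov distance -/

theorem isMetric_lpDist (H : Type u) [MetricSpace H] [MeasurableSpace H] [BorelSpace H] :
    IsMetric (lpDist (H := H)) where
  nonneg _ _ := ENNReal.toReal_nonneg
  eq_zero_iff P Q :=
    (dist_eq_zero (x := LevyProkhorov.ofMeasure P) (y := LevyProkhorov.ofMeasure Q)).trans
      LevyProkhorov.toMeasureEquiv.symm.injective.eq_iff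
  symm _ _ := levyProkhorovDist_comm _ _
  triangle _ _ _ := levyProkhorovDist_triangle _ _ _

/-- Condition D restates that the Lévy–Prokhorov distance metrizes convergence in distribution. -/
theorem condD_lpDist (H : Type u) [MetricSpace H] [TopologicalSpace.SeparableSpace H]
    [MeasurableSpace H] [BorelSpace H] : CondD (lpDist (H := H)) := by
  intro P Q
  rw [← ProbabilityMeasure.tendsto_iff_forall_integral_tendsto,
    LevyProkhorov.probabilityMeasureHomeomorph.isInducing.tendsto_nhds_iff,
    tendsto_iff_dist_tendsto_zero
      (a := (LevyProkhorov.probabilityMeasureHomeomorph (Ω := H)) Q)]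
  rfl

/-- A one-sided estimate on all measurable sets bounds the Lévy–Prokhorov distance. -/
theorem lpDist_le_of_forall_le {H : Type u} [MetricSpace H] [MeasurableSpace H] [BorelSpace H]
    {P Q : ProbabilityMeasure H} {ε : ℝ} (hε : 0 < ε)
    (h : ∀ A, MeasurableSet A →
      (P : Measure H) A ≤ (Q : Measure H) (Metric.thickening ε A) + ENNReal.ofReal ε) :
    lpDist P Q ≤ ε := by
  refine levyProkhorovDist_le_of_forall_le _ _ hε.le fun δ B hδ hB => (h B hB).trans ?_
  gcongr

theorem tendsto_lpDist_zero_iff {H : Type u} [MetricSpace H] [MeasurableSpace H] [BorelSpace H]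
    {P Q : ℕ → ProbabilityMeasure H} :
    Tendsto (fun n => lpDist (P n) (Q n)) atTop (𝓝 0) ↔
      ∀ ε > 0, ∀ᶠ n in atTop, lpDist (P n) (Q n) ≤ ε := by
  refine ⟨fun h ε hε => h.eventually_le_const hε, fun h => ?_⟩
  refine Metric.tendsto_nhds.2 fun ε hε => ?_
  filter_upwards [h (ε / 2) (half_pos hε)] with n hn
  rw [Real.dist_0_eq_abs, abs_of_nonneg ((isMetric_lpDist H).nonneg _ _)]
  linarith

theorem measure_le_of_lpDist_lt {H : Type u} [MetricSpace H] [MeasurableSpace H]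
    {P Q : ProbabilityMeasure H} {ε : ℝ} (h : lpDist P Q < ε) {A : Set H} (hA : MeasurableSet A) :
    (P : Measure H) A ≤ (Q : Measure H) (Metric.thickening ε A) + ENNReal.ofReal ε := by
  have hε : 0 < ε := ENNReal.toReal_nonneg.trans_lt h
  have hlt : levyProkhorovEDist (P : Measure H) Q < ENNReal.ofReal ε :=
    (ENNReal.lt_ofReal_iff_toReal_lt (levyProkhorovEDist_ne_top _ _)).2 h
  have := left_measure_le_of_levyProkhorovEDist_lt hlt hA
  rwa [ENNReal.toReal_ofReal hε.le] at this

/-- If `X ∈ A`, then `Y` lies in the `ε`-thickening of `A` unless `ε ≤ dist X Y`. -/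
theorem condA_lpDist (H : Type u) [MetricSpace H] [MeasurableSpace H] [BorelSpace H] :
    CondA.{u, w} (lpDist (H := H)) := by
  intro Ω _ μ X Y hX hY h
  refine tendsto_lpDist_zero_iff.2 fun ε hε => ?_
  have h0 := h (ENNReal.ofReal ε) (by simpa using hε)
  filter_upwards [h0.eventually_le_const (by simpa using hε : (0 : ℝ≥0∞) < ENNReal.ofReal ε)]
    with n hn
  refine lpDist_le_of_forall_le hε fun A hA => ?_
  rw [ProbabilityMeasure.toMeasure_map, ProbabilityMeasure.toMeasure_map,
    Measure.map_apply (hX n) hA,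
    Measure.map_apply (hY n) Metric.isOpen_thickening.measurableSet]
  refine le_trans ?_ (add_le_add_right hn _)
  refine le_trans (measure_mono fun ω hω => ?_) (measure_union_le _ _)
  by_cases hd : ε ≤ dist (X n ω) (Y n ω)
  · right
    simpa [edist_dist, ENNReal.ofReal_le_ofReal_iff] using hd
  · left
    exact Metric.mem_thickening_iff.2 ⟨X n ω, hω, by rw [dist_comm]; exact not_le.1 hd⟩

/-- Preimages under a uniformly continuous `f` satisfy `(f ⁻¹' A)^δ ⊆ f ⁻¹' (A^ε)`. -/
theorem condC_lpDist (H : Type u) [MetricSpace H] [MeasurableSpace H] [BorelSpace H]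
    (K : Type v) [MetricSpace K] [MeasurableSpace K] [BorelSpace K] :
    CondC (lpDist (H := H)) (lpDist (H := K)) := by
  intro f hf P Q h
  refine tendsto_lpDist_zero_iff.2 fun ε hε => ?_
  obtain ⟨δ, hδ, hfδ⟩ := Metric.uniformContinuous_iff.1 hf ε hε
  filter_upwards [h.eventually_lt_const (lt_min hδ hε)] with n hn
  refine lpDist_le_of_forall_le hε fun A hA => ?_
  have hm := hf.continuous.measurable
  rw [ProbabilityMeasure.toMeasure_map, ProbabilityMeasure.toMeasure_map, Measure.map_apply hm hA,
    Measure.map_apply hm Metric.isOpen_thickening.measurableSet]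
  refine (measure_le_of_lpDist_lt hn (hm hA)).trans ?_
  gcongr
  · intro x hx
    obtain ⟨y, hy, hxy⟩ := Metric.mem_thickening_iff.1 hx
    exact Metric.mem_thickening_iff.2 ⟨f y, hy, hfδ (hxy.trans_le (min_le_left _ _))⟩
  · exact min_le_right _ _

/-! ### Nearly diagonal couplings -/

theorem eventually_one_le_sum_measure {α : Type*} [MeasurableSpace α] (P : Measure α)
    [IsProbabilityMeasure P] {A : ℕ → Set α} (hA : ∀ n, MeasurableSet (A n))
    (hd : Pairwise (Function.onFun Disjoint A)) (hU : ⋃ n, A n = Set.univ) {ε : ℝ≥0∞}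
    (hε : 0 < ε) : ∀ᶠ m in atTop, 1 ≤ ∑ i : Fin m, P (A i) + ε := by
  have h1 : ∑' n, P (A n) = 1 := by rw [← measure_iUnion hd hA, hU, measure_univ]
  have h2 : Tendsto (fun m => ∑ i ∈ Finset.range m, P (A i)) atTop (𝓝 1) :=
    h1 ▸ ENNReal.summable.hasSum.tendsto_sum_nat
  filter_upwards [h2.eventually_const_le
    (ENNReal.sub_lt_self ENNReal.one_ne_top one_ne_zero hε.ne')] with m hm
  rw [Fin.sum_univ_eq_sum_range (fun i => P (A i))]
  exact tsub_le_iff_right.1 hm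

/-- The approximate Strassen theorem: a bound on the Lévy–Prokhorov distance yields a coupling that
is close to the diagonal with high probability. The optimal constants would be `1` in both places;
the loss is harmless for sequences tending to zero. -/
theorem exists_coupling_of_lpDist_lt {H : Type u} [MetricSpace H]
    [TopologicalSpace.SeparableSpace H] [MeasurableSpace H] [BorelSpace H]
    {P Q : ProbabilityMeasure H} {ε : ℝ} (h : lpDist P Q < ε) :
    ∃ γ : Measure (H × H), γ.fst = P ∧ γ.snd = Q ∧
      γ {z | 3 * ε < dist z.1 z.2} ≤ ENNReal.ofReal (4 * ε) := by
  classical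
  have hε : 0 < ε := ENNReal.toReal_nonneg.trans_lt h
  lift ε to NNReal using hε.le
  have hε' : 0 < ε := hε
  obtain ⟨A, hA, hAb, hAε, hAU, hAd⟩ :=
    SeparableSpace.exists_measurable_partition_diam_le H hε
  have hE : (0 : ℝ≥0∞) < ε := by exact_mod_cast hε'
  obtain ⟨m, hPm, hQm⟩ := ((eventually_one_le_sum_measure (P : Measure H) hA hAd hAU hE).and
    (eventually_one_le_sum_measure (Q : Measure H) hA hAd hAU hE)).exists
  have hAd' : Pairwise (Function.onFun Disjoint fun i : Fin m => A i) :=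
    fun i j hij => hAd (Fin.val_injective.ne hij)
  have hQc : (Q : Measure H) (⋃ i : Fin m, A i)ᶜ ≤ ε := by
    have hm : MeasurableSet (⋃ i : Fin m, A i) := .iUnion fun i => hA i
    rw [prob_compl_eq_one_sub hm, tsub_le_iff_left,
      measure_iUnion hAd' (fun i => hA i), tsum_fintype]
    exact hQm
  -- Cells are related when they come within distance `ε` of each other. The marriage condition then
  -- holds with deficiency `2ε`: one `ε` from the definition of the distance, one from the mass that
  -- `Q` gives to the cells with index at least `m`.
  obtain ⟨w, hwR, hwP, hwQ, hwtot⟩ := exists_transport_of_hall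
    (fun i j : Fin m => ∃ x ∈ A i, ∃ y ∈ A j, dist x y < ε)
    (fun i => P (A i)) (fun j => Q (A j)) (ε + ε) ε hε' (by
      intro S
      rw [← ENNReal.coe_le_coe]
      push_cast
      simp only [ProbabilityMeasure.ennreal_coeFn_eq_coeFn_toMeasure]
      set T := Finset.univ.filter fun j : Fin m =>
        ∃ i ∈ S, ∃ x ∈ A i, ∃ y ∈ A j, dist x y < ε
      rw [← measure_biUnion_finset (fun i _ j _ hij => hAd' hij) fun i _ => hA i]
      calc (P : Measure H) (⋃ i ∈ S, A i)
          ≤ (Q : Measure H) (Metric.thickening ε (⋃ i ∈ S, A i)) + ENNReal.ofReal ε :=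
            measure_le_of_lpDist_lt h (Finset.measurableSet_biUnion _ fun i _ => hA i)
        _ ≤ (Q : Measure H) ((⋃ j ∈ T, A j) ∪ (⋃ i : Fin m, A i)ᶜ) + ε := by
            rw [ENNReal.ofReal_coe_nnreal]
            gcongr
            intro y hy
            by_cases hyA : y ∈ ⋃ i : Fin m, A i
            · left
              obtain ⟨j, hj⟩ := Set.mem_iUnion.1 hyA
              obtain ⟨x, hx, hxy⟩ := Metric.mem_thickening_iff.1 hy
              obtain ⟨i, hi, hxi⟩ := Set.mem_iUnion₂.1 hx
              refine Set.mem_iUnion₂.2 ⟨j, ?_, hj⟩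
              simp only [T, Finset.mem_filter, Finset.mem_univ, true_and]
              exact ⟨i, hi, x, hxi, y, hj, by rwa [dist_comm]⟩
            · exact Or.inr hyA
        _ ≤ ((Q : Measure H) (⋃ j ∈ T, A j) + ε) + ε := by
            gcongr
            exact (measure_union_le _ _).trans (by gcongr)
        _ ≤ _ := by
            rw [add_assoc]
            gcongr
            convert! measure_biUnion_finset_le (μ := (Q : Measure H)) T fun j : Fin m => A j)
  obtain ⟨γ, hγP, hγQ, hγ1, hγ0⟩ := exists_subcoupling (P : Measure H) (Q : Measure H)
    (fun i : Fin m => hA i) (fun i : Fin m => hA i) hAd' hAd' w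
    (fun i => by
      rw [← ProbabilityMeasure.ennreal_coeFn_eq_coeFn_toMeasure]; exact_mod_cast hwP i)
    (fun j => by
      rw [← ProbabilityMeasure.ennreal_coeFn_eq_coeFn_toMeasure]; exact_mod_cast hwQ j)
  obtain ⟨Γ, hΓP, hΓQ, hΓ⟩ := exists_coupling_le_add_missing_mass hγP hγQ
  -- The uncoupled mass is at most `4ε`: the deficiency `2ε`, the tail of `P` and the slack `ε` in the
  -- transport plan. Coupled points lie within three lengths of at most `ε`.
  refine ⟨Γ, hΓP, hΓQ, (hΓ _).trans ?_⟩
  rw [hγ0, zero_add, hγ1, tsub_le_iff_left]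
  · have h1 : (∑ i : Fin m, (P : Measure H) (A i)) ≤
        ∑ i, ∑ j, (w i j : ℝ≥0∞) + (ε + ε) + ε := by
      simp only [← ProbabilityMeasure.ennreal_coeFn_eq_coeFn_toMeasure]
      exact_mod_cast hwtot
    have h4 : ENNReal.ofReal (4 * ε) = ε + ε + ε + ε := by
      rw [← ENNReal.ofReal_coe_nnreal, ← ENNReal.ofReal_add, ← ENNReal.ofReal_add,
        ← ENNReal.ofReal_add] <;> first | positivity | (congr 1; ring)
    calc (1 : ℝ≥0∞) ≤ ∑ i : Fin m, (P : Measure H) (A i) + ε := hPm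
      _ ≤ ∑ i, ∑ j, (w i j : ℝ≥0∞) + (ε + ε) + ε + ε := by gcongr
      _ = _ := by rw [h4]; ring
  · intro i j hij
    obtain ⟨x, hx, y, hy, hxy⟩ := hwR i j hij
    refine Set.disjoint_left.2 fun z hz hzA => ?_
    have h1 := (Metric.dist_le_diam_of_mem (hAb i) hzA.1 hx).trans (hAε i)
    have h2 := (Metric.dist_le_diam_of_mem (hAb j) hy hzA.2).trans (hAε j)
    have h3 := dist_triangle4 z.1 x y z.2
    simp only [Set.mem_ofPred_eq] at hz
    linarith

/-! ### Realisation on one probability space -/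

/-- Every sequence of laws on a standard Borel space is realised by random elements on one
probability space in an arbitrary universe: the countable product is again standard Borel, hence
embeds measurably into `ℝ`, which is then lifted. -/
theorem exists_random_elements_map_eq {E : Type u} [MeasurableSpace E] [StandardBorelSpace E]
    [Nonempty E] (γ : ℕ → Measure E) [∀ n, IsProbabilityMeasure (γ n)] :
    ∃ (μ : ProbabilityMeasure (ULift.{w} ℝ)) (Z : ℕ → ULift.{w} ℝ → E),
      (∀ n, Measurable (Z n)) ∧ ∀ n, (μ : Measure (ULift.{w} ℝ)).map (Z n) = γ n := by
  have he := measurableEmbedding_embeddingReal (ℕ → E)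
  obtain ⟨g, hg, hgE⟩ := he.exists_measurable_extend measurable_id fun _ => inferInstance
  have hem : Measurable fun z : ℕ → E => (ULift.up (embeddingReal _ z) : ULift.{w} ℝ) :=
    measurable_up.comp he.measurable
  have hgm : ∀ n, Measurable fun x : ULift.{w} ℝ => g x.down n := fun n =>
    (measurable_pi_apply n).comp (hg.comp measurable_down)
  obtain ⟨ν, hν⟩ : ∃ ν : ProbabilityMeasure (ℕ → E),
      (ν : Measure (ℕ → E)) = Measure.infinitePi γ := ⟨⟨Measure.infinitePi γ, inferInstance⟩, rfl⟩
  refine ⟨ν.map hem.aemeasurable,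
    fun n x => g x.down n, hgm, fun n => ?_⟩
  rw [ProbabilityMeasure.toMeasure_map, Measure.map_map (hgm n) hem, hν,
    ← Measure.infinitePi_map_eval γ n]
  congr 1
  funext z
  exact congrFun (congrFun hgE z) n

/-- Condition B: the couplings of the pairs `P n`, `Q n` given by the approximate Strassen theorem
are put on one probability space. -/
theorem condB_lpDist (H : Type u) [MetricSpace H] [CompleteSpace H]
    [TopologicalSpace.SeparableSpace H] [MeasurableSpace H] [BorelSpace H] :
    CondB.{u, w} (lpDist (H := H)) := by
  intro P Q h
  have : Nonempty H := (P 0).nonempty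
  -- The distance may be zero, so `1 / (n + 1)` is added to have a strict upper bound.
  have hpos : ∀ n : ℕ, (0 : ℝ) < 1 / (n + 1) := fun n => by positivity
  choose γ hP hQ hγ using fun n =>
    exists_coupling_of_lpDist_lt (lt_add_of_pos_right (lpDist (P n) (Q n)) (hpos n))
  have hγp : ∀ n, IsProbabilityMeasure (γ n) := fun n =>
    ⟨by rw [← Measure.fst_univ, hP, measure_univ]⟩
  have : PolishSpace H := inferInstance
  obtain ⟨μ, Z, hn, hμ⟩ := exists_random_elements_map_eq.{u, w} γ
  refine ⟨ULift.{w} ℝ, inferInstance, μ, fun n x => (Z n x).1, fun n x => (Z n x).2,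
    fun n => (hn n).fst, fun n => (hn n).snd, fun n => ?_, fun n => ?_, fun δ hδ => ?_⟩
  · apply ProbabilityMeasure.toMeasure_injective
    rw [ProbabilityMeasure.toMeasure_map, ← hP n, ← hμ n, Measure.fst,
      Measure.map_map measurable_fst (hn n)]
    rfl
  · apply ProbabilityMeasure.toMeasure_injective
    rw [ProbabilityMeasure.toMeasure_map, ← hQ n, ← hμ n, Measure.snd,
      Measure.map_map measurable_snd (hn n)]
    rfl
  · have hlim : Tendsto (fun n : ℕ => lpDist (P n) (Q n) + 1 / ((n : ℝ) + 1)) atTop (𝓝 0) := by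
      simpa using h.add tendsto_one_div_add_atTop_nhds_zero_nat
    have h4 : Tendsto (fun n : ℕ => ENNReal.ofReal (4 * (lpDist (P n) (Q n) + 1 / ((n : ℝ) + 1))))
        atTop (𝓝 0) := by
      simpa using ENNReal.tendsto_ofReal (hlim.const_mul 4)
    have h3 : Tendsto (fun n : ℕ => ENNReal.ofReal (3 * (lpDist (P n) (Q n) + 1 / ((n : ℝ) + 1))))
        atTop (𝓝 0) := by
      simpa using ENNReal.tendsto_ofReal (hlim.const_mul 3)
    refine tendsto_of_tendsto_of_tendsto_of_le_of_le' tendsto_const_nhds h4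
      (.of_forall fun _ => zero_le) ?_
    filter_upwards [h3.eventually_lt_const hδ] with n hδn
    refine le_trans ?_ (hγ n)
    rw [← hμ n, Measure.map_apply (hn n) (measurableSet_lt measurable_const measurable_dist)]
    refine measure_mono fun x hx => ?_
    have hx' : δ ≤ ENNReal.ofReal (dist (Z n x).1 (Z n x).2) := by
      simpa [edist_dist] using hx
    exact (ENNReal.ofReal_lt_ofReal_iff_of_nonneg (by
      have := hpos n
      have : 0 ≤ lpDist (P n) (Q n) := ENNReal.toReal_nonneg
      positivity)).1 (hδn.trans_le hx')

/-! ### Uniqueness up to uniform equivalence -/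

/-- Conditions A and B speak of random elements only, so B for one distance feeds A for another. -/
theorem tendsto_zero_of_condB_of_condA {H : Type u} [MetricSpace H] [MeasurableSpace H]
    {r s : ProbabilityMeasure H → ProbabilityMeasure H → ℝ} (hr : CondB.{u, w} r)
    (hs : CondA.{u, w} s) {P Q : ℕ → ProbabilityMeasure H}
    (h : Tendsto (fun n => r (P n) (Q n)) atTop (𝓝 0)) :
    Tendsto (fun n => s (P n) (Q n)) atTop (𝓝 0) := by
  obtain ⟨Ω, _, μ, X, Y, hX, hY, hP, hQ, hXY⟩ := hr P Q h
  simpa only [hP, hQ] using hs Ω μ X Y hX hY hXY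

theorem theorem2 (H : Type u) [MetricSpace H] [CompleteSpace H]
    [TopologicalSpace.SeparableSpace H] [MeasurableSpace H] [BorelSpace H] :
    (IsMetric (lpDist (H := H)) ∧
      CondA.{u, w} (lpDist (H := H)) ∧
      CondB.{u, w} (lpDist (H := H)) ∧
      (∀ (K : Type v) [MetricSpace K] [CompleteSpace K] [TopologicalSpace.SeparableSpace K]
        [MeasurableSpace K] [BorelSpace K], CondC (lpDist (H := H)) (lpDist (H := K))) ∧
      CondD (lpDist (H := H))) ∧
    ∀ r : ProbabilityMeasure H → ProbabilityMeasure H → ℝ, IsMetric r →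
      CondA.{u, w} r → CondB.{u, w} r → UniformlyEquivalent r (lpDist (H := H)) := by
  exact ⟨⟨isMetric_lpDist H, condA_lpDist H, condB_lpDist H, fun K => condC_lpDist H K,
    condD_lpDist H⟩, fun _ _ hA hB _ _ => ⟨tendsto_zero_of_condB_of_condA hB (condA_lpDist H),
      tendsto_zero_of_condB_of_condA (condB_lpDist.{u, w} H) hA⟩⟩
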